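/- **Linear convergence of piggyback derivatives.** Let $F\colon\mathbb{R}^p\times\mathbb{R}^m\to\mathbb{R}^p$ be locally Lipschitz and semialgebraic, with a *Lipschitz gradient selection* $(s,F_1,\dots,F_M)$: the index map $s\colon\mathbb{R}^p\times\mathbb{R}^m\to\{1,\dots,M\}$ is semialgebraic, the maps $F_i\colon\mathbb{R}^p\times\mathbb{R}^m\to\mathbb{R}^p$ are semialgebraic and differentiable with $L$-Lipschitz Jacobians for a common $L\ge 0$, and $F(z)=F_{s(z)}(z)$ for all $z=(x,\theta)$. Let $$J_F^s(z)=\operatorname{conv}\{\operatorname{Jac}F_i(z) : 1\le i\le M,\ F_i(z)=F(z)\},$$ and write its elements as $[A,B]$ with $A\in\mathbb{R}^{p\times p}$, $B\in\mathbb{R}^{p\times m}$. Suppose there is $0\le\rho<1$ such that $\|A\|_{\mathrm{op}}\le\rho$ for all $(x,\theta)$ and all $[A,B]\in J_F^s(x,\theta)$. Let $x_0\colon\mathbb{R}^m\to\mathbb{R}^p$ be locally Lipschitz, and set $x_{k+1}(\theta)=F(x_k(\theta),\theta)$. For each $\theta$ let $J_{x_0}(\theta)\subset\mathbb{R}^{p\times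 m}$ be nonempty and compact (for instance the value of a conservative Jacobian of $x_0$), and set $$J_{x_{k+1}}(\theta)=\{AJ+B : [A,B]\in J_F^s(x_k(\theta),\theta),\ J\in J_{x_k}(\theta)\}.$$ For nonempty compact $\mathcal{X},\mathcal{Y}\subset\mathbb{R}^{p\times m}$ let $\operatorname{gap}(\mathcal{X},\mathcal{Y})=\max_{X\in\mathcal{X}}\min_{Y\in\mathcal{Y}}\|X-Y\|$, where $\|\cdot\|$ is a fixed norm, say the operator norm (the choice only affects the constants $C$ below). Then $F(\cdot,\theta)$ has a unique fixed point $\bar x(\theta)$ for every $\theta$, and there is a unique nonempty compact set $J^{\mathrm{alg}}_{\bar x}(\theta)\subset\mathbb{R}^{p\times m}$ with $$J^{\mathrm{alg}}_{\bar x}(\theta)=\{AJ+B : [A,B]\in J_F^s(\bar x(\theta),\theta),\ J\in J^{\mathrm{alg}}_{\bar x}(\theta)\}.$$ For every $\theta\in\mathbb{R}^m$ and $\epsilon>0$ there is $C>0$ such that $$\operatorname{gap}\bigl(J_{x_k}(\theta),J^{\mathrm{alg}}_{\bar x}(\theta)\bigr)\le C(\sqrt{\rho}+\epsilon)^k\qquad\text{for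 all }k\in\mathbb{N}.$$ Moreover, for Lebesgue-almost every $\theta$, the map $\bar x$ and all the maps $x_k$ are differentiable at $\theta$, and the classical Jacobians converge at the same linear rate: for every $\epsilon>0$ there is $C>0$ such that $$\Bigl\|\tfrac{\partial x_k}{\partial\theta}(\theta)-\tfrac{\partial\bar x}{\partial\theta}(\theta)\Bigr\|\le C(\sqrt{\rho}+\epsilon)^k\qquad\text{for all }k\in\mathbb{N}.$$ -/

import Mathlib

open scoped ENNReal

namespace Piggyback

/-- Semialgebraic subsets of `ℝ^σ`: the smallest Boolean algebra of sets containing all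
`{v | P v = 0}` and `{v | 0 < P v}` with `P` a real polynomial. -/
inductive IsSemialgebraic {σ : Type} : Set (σ → ℝ) → Prop
  | zeroSet (P : MvPolynomial σ ℝ) : IsSemialgebraic {v | MvPolynomial.eval v P = 0}
  | posSet (P : MvPolynomial σ ℝ) : IsSemialgebraic {v | 0 < MvPolynomial.eval v P}
  | compl {S : Set (σ → ℝ)} : IsSemialgebraic S → IsSemialgebraic Sᶜ
  | union {S T : Set (σ → ℝ)} : IsSemialgebraic S → IsSemialgebraic T → IsSemialgebraic (S ∪ T)

/-- A map `ℝ^p × ℝ^m → ℝ^q` is semialgebraic if its graph, a subset of `ℝ^(p+m+q)`, is. -/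
def SemialgebraicMap {p m q : ℕ}
    (f : EuclideanSpace ℝ (Fin p) × EuclideanSpace ℝ (Fin m) → EuclideanSpace ℝ (Fin q)) : Prop :=
  IsSemialgebraic {v : (Fin p ⊕ Fin m) ⊕ Fin q → ℝ |
    f (WithLp.toLp 2 (fun i => v (Sum.inl (Sum.inl i))),
       WithLp.toLp 2 (fun j => v (Sum.inl (Sum.inr j)))) =
      WithLp.toLp 2 (fun i => v (Sum.inr i))}

/-- `(s, f 0, …, f (M - 1))` is a Lipschitz gradient selection of the continuous semialgebraic
map `F`: the index map `s` (viewed as a map to `ℝ^1`) and the maps `f i` are semialgebraic, the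
`f i` are differentiable with Jacobians that are Lipschitz with one common constant, and
`F z = f (s z) z` for all `z`. -/
structure IsLipschitzGradientSelection {p m q M : ℕ}
    (F : EuclideanSpace ℝ (Fin p) × EuclideanSpace ℝ (Fin m) → EuclideanSpace ℝ (Fin q))
    (s : EuclideanSpace ℝ (Fin p) × EuclideanSpace ℝ (Fin m) → Fin M)
    (f : Fin M → EuclideanSpace ℝ (Fin p) × EuclideanSpace ℝ (Fin m) →
      EuclideanSpace ℝ (Fin q)) : Prop where
  continuous : Continuous F
  semialgebraic : SemialgebraicMap F
  semialgebraic_index :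
    SemialgebraicMap (q := 1) (fun z => WithLp.toLp 2 (fun _ => (((s z : ℕ) + 1 : ℕ) : ℝ)))
  semialgebraic_piece : ∀ i, SemialgebraicMap (f i)
  differentiable : ∀ i, Differentiable ℝ (f i)
  lipschitz_jacobian : ∃ L : NNReal, ∀ i, LipschitzWith L (fderiv ℝ (f i))
  selection : ∀ z, F z = f (s z) z

section Normed

variable {E G : Type*} [NormedAddCommGroup E] [NormedSpace ℝ E]
  [NormedAddCommGroup G] [NormedSpace ℝ G]

/-- The selection Jacobian: at `z`, the convex hull of the Jacobians at `z` of those pieces `f i`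
that are active at `z`, that is, `F z = f i z`. -/
def selectionJacobian {ι : Type*} (F : E × G → E) (f : ι → E × G → E) (z : E × G) :
    Set (E × G →L[ℝ] E) :=
  convexHull ℝ {T | ∃ i, F z = f i z ∧ T = fderiv ℝ (f i) z}

/-- The block `A` of `T = [A, B]`. -/
def blockA (T : E × G →L[ℝ] E) : E →L[ℝ] E := T.comp (ContinuousLinearMap.inl ℝ E G)

/-- The block `B` of `T = [A, B]`. -/
def blockB (T : E × G →L[ℝ] E) : G →L[ℝ] E := T.comp (ContinuousLinearMap.inr ℝ E G)

/-- The action `𝒥(𝒳) = {A X + B | [A, B] ∈ 𝒥, X ∈ 𝒳}`. -/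
def act (𝒥 : Set (E × G →L[ℝ] E)) (𝒳 : Set (G →L[ℝ] E)) : Set (G →L[ℝ] E) :=
  {Y | ∃ T ∈ 𝒥, ∃ X ∈ 𝒳, Y = (blockA T).comp X + blockB T}

/-- `K` is a nonempty compact fixed set of `𝒥`. -/
def IsFixedSet (𝒥 : Set (E × G →L[ℝ] E)) (K : Set (G →L[ℝ] E)) : Prop :=
  K.Nonempty ∧ IsCompact K ∧ act 𝒥 K = K

/-- The iterates `x_{k+1}(θ) = F (x_k(θ), θ)`. -/
def iter (F : E × G → E) (x₀ : G → E) : ℕ → G → E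
  | 0, θ => x₀ θ
  | k + 1, θ => F (iter F x₀ k θ, θ)

/-- The set-valued piggyback recursion
`J_{x_{k+1}}(θ) = {A J + B | [A, B] ∈ J_F(x_k(θ), θ), J ∈ J_{x_k}(θ)}`. -/
def piggyback (F : E × G → E) (JF : E × G → Set (E × G →L[ℝ] E)) (x₀ : G → E)
    (J₀ : G → Set (G →L[ℝ] E)) : ℕ → G → Set (G →L[ℝ] E)
  | 0, θ => J₀ θ
  | k + 1, θ => act (JF (iter F x₀ k θ, θ)) (piggyback F JF x₀ J₀ k θ)

end Normed

/-- `gap(𝒳, 𝒴) = sup_{x ∈ 𝒳} inf_{y ∈ 𝒴} d(x, y)`; the supremum and the infimum are attained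
when both sets are nonempty and compact. -/
noncomputable def gap {V : Type*} [PseudoEMetricSpace V] (𝒳 𝒴 : Set V) : ℝ≥0∞ :=
  ⨆ x ∈ 𝒳, ⨅ y ∈ 𝒴, edist x y

end Piggyback

open Filter Topology Set MeasureTheory
open scoped NNReal Pointwise

set_option linter.unusedSectionVars false

namespace Piggyback

/-! ### Continuous selections: contraction in the first variable -/

section Selection

variable {E G : Type*} [NormedAddCommGroup E] [NormedSpace ℝ E]
  [NormedAddCommGroup G] [NormedSpace ℝ G]

/-! Near a point only pieces active there can be active, so along a segment the increments of `F`
are controlled by the derivatives of active pieces. Hence `F(·, θ)` is a `ρ`-contraction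
(`norm_sub_le_of_blockA_le`), and Banach's theorem gives `xbar`. The action of the selection
Jacobian contracts the Hausdorff distance by `ρ`, which gives `Jalg`.

For the rate, the selection Jacobian at `(x_k, θ)` lies within `L‖x_k - xbar‖ = O(ρ ^ k)` of the one
at the limit once `k` is large. The distances to `Jalg` therefore satisfy `a_{k+1} ≤ ρ a_k + D r ^
k` for any `r > ρ`, whence `a_k = O(r ^ k)` (`exists_piggyback_bound`). As `ρ ≤ √ρ`, this covers the
stated rate.

For classical Jacobians, Rademacher's theorem and the a.e. equality of derivatives on coincidence
sets show that almost everywhere every element of the selection Jacobian satisfies the chain rule.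
There `{D xbar}` is a fixed set and `D x_k` belongs to the recursion started at `{D x₀}`, so the
same bound applies. -/

theorem blockA_comp_add_blockB (T : E × G →L[ℝ] E) (X : G →L[ℝ] E) :
    (blockA T).comp X + blockB T = T.comp (X.prod (ContinuousLinearMap.id ℝ G)) := by
  ext v
  simp [blockA, blockB, ← map_add]

variable {ι : Type*} {F : E × G → E} {f : ι → E × G → E} {ρ : ℝ}

theorem fderiv_mem_selectionJacobian {i : ι} {z : E × G} (h : F z = f i z) :
    fderiv ℝ (f i) z ∈ selectionJacobian F f z :=
  subset_convexHull ℝ _ ⟨i, h, rfl⟩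

theorem isCompact_selectionJacobian [Finite ι] (F : E × G → E) (f : ι → E × G → E) (z : E × G) :
    IsCompact (selectionJacobian F f z) := by
  refine Set.Finite.isCompact_convexHull ℝ ((Set.finite_range fun i => fderiv ℝ (f i) z).subset ?_)
  rintro _ ⟨i, _, rfl⟩
  exact ⟨i, rfl⟩

/-- Near a point `z`, only the pieces that are active at `z` can be active. -/
theorem eventually_active [Finite ι] (hF : Continuous F) (hf : ∀ i, Continuous (f i))
    (z : E × G) : ∀ᶠ w in 𝓝 z, ∀ i, F w = f i w → F z = f i z := by
  refine eventually_all.2 fun i => ?_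
  by_cases h : F z = f i z
  · exact Eventually.of_forall fun _ _ => h
  · filter_upwards [(isOpen_ne_fun hF (hf i)).mem_nhds h] with w hw hw'
    exact absurd hw' hw

/-- A continuous selection of differentiable maps is Lipschitz in its first variable as soon as
the partial derivatives of its active pieces are bounded. -/
theorem norm_sub_le_of_blockA_le [Finite ι] (hF : Continuous F)
    (hf : ∀ i, Differentiable ℝ (f i)) (hs : ∀ z, ∃ i, F z = f i z)
    (hρ : ∀ z, ∀ T ∈ selectionJacobian F f z, ‖blockA T‖ ≤ ρ) (x y : E) (θ : G) :
    ‖F (x, θ) - F (y, θ)‖ ≤ ρ * ‖x - y‖ := by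
  set γ : ℝ → E × G := fun t => (y + t • (x - y), θ) with hγ
  have hγd : ∀ t, HasDerivAt γ (x - y, 0) t := fun t => by
    have h1 : HasDerivAt (fun t : ℝ => y + t • (x - y)) (x - y) t := by
      simpa using ((hasDerivAt_id t).smul_const (x - y)).const_add y
    exact h1.prodMk (hasDerivAt_const t θ)
  have hγc : Continuous γ := continuous_iff_continuousAt.2 fun t => (hγd t).continuousAt
  -- `F ∘ γ` need not be differentiable; this mean value inequality only asks that right slopes drop
  -- below every `r > ρ * ‖x - y‖`.
  have key := image_le_of_liminf_slope_right_le_deriv_boundary (a := 0) (b := 1)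
    (f := fun t => ‖F (γ t) - F (γ 0)‖) (B := fun t => ρ * ‖x - y‖ * t)
    (B' := fun _ => ρ * ‖x - y‖)
    (((hF.comp hγc).sub continuous_const).norm.continuousOn) (by simp)
    (by fun_prop)
    (fun t _ => by simpa using ((hasDerivAt_id t).const_mul (ρ * ‖x - y‖)).hasDerivWithinAt)
    (fun t _ r hr => ?_)
  · have := key (right_mem_Icc.2 zero_le_one)
    simpa [hγ] using this
  refine Eventually.frequently ?_
  have hact : ∀ᶠ u in 𝓝[>] t, ∀ i, F (γ u) = f i (γ u) → F (γ t) = f i (γ t) :=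
    nhdsWithin_le_nhds ((hγc.tendsto t).eventually
      (eventually_active hF (fun i => (hf i).continuous) (γ t)))
  have hslope : ∀ᶠ u in 𝓝[>] t, ∀ i, F (γ t) = f i (γ t) →
      ‖slope (f i ∘ γ) t u‖ < r := by
    refine eventually_all.2 fun i => ?_
    by_cases h : F (γ t) = f i (γ t)
    · have hd : HasDerivAt (f i ∘ γ) (fderiv ℝ (f i) (γ t) (x - y, 0)) t :=
        ((hf i) (γ t)).hasFDerivAt.comp_hasDerivAt t (hγd t)
      have hlt : ‖fderiv ℝ (f i) (γ t) (x - y, 0)‖ < r := by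
        refine lt_of_le_of_lt ?_ hr
        calc ‖fderiv ℝ (f i) (γ t) (x - y, 0)‖
            = ‖blockA (fderiv ℝ (f i) (γ t)) (x - y)‖ := by simp [blockA]
          _ ≤ _ := (blockA (fderiv ℝ (f i) (γ t))).le_of_opNorm_le
            (hρ _ _ (fderiv_mem_selectionJacobian h)) _
      have ht := (hasDerivAt_iff_tendsto_slope.1 hd).norm.mono_left
        (nhdsWithin_mono t fun u (hu : t < u) => hu.ne')
      filter_upwards [ht.eventually_lt_const hlt] with u hu _ using hu
    · exact Eventually.of_forall fun _ h' => absurd h' h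
  filter_upwards [hact, hslope, self_mem_nhdsWithin] with u h1 h2 hu
  -- A piece active at `γ u` is also active at `γ t`, so it has the same increment as `F` between
  -- the two points.
  obtain ⟨i, hi⟩ := hs (γ u)
  have hi' := h1 i hi
  refine lt_of_le_of_lt ?_ (h2 i hi')
  have hpos : 0 < u - t := sub_pos.2 hu
  rw [slope_def_field, slope_def_module, norm_smul, norm_inv, Real.norm_of_nonneg hpos.le,
    div_eq_inv_mul]
  gcongr
  refine (norm_sub_norm_le _ _).trans (le_of_eq ?_)
  simp [hi, hi']

/-! ### The fixed point map -/

theorem exists_fixedPoint_map [CompleteSpace E] (hρ0 : 0 ≤ ρ) (hρ1 : ρ < 1)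
    (hlip : ∀ x y θ, ‖F (x, θ) - F (y, θ)‖ ≤ ρ * ‖x - y‖) :
    ∃ xbar : G → E, ∀ θ x, F (x, θ) = x ↔ x = xbar θ := by
  lift ρ to ℝ≥0 using hρ0
  have hc : ∀ θ, ContractingWith ρ fun x => F (x, θ) := fun θ =>
    ⟨by exact_mod_cast hρ1, LipschitzWith.of_dist_le_mul fun x y => by
      simpa [dist_eq_norm] using hlip x y θ⟩
  refine ⟨fun θ => (hc θ).fixedPoint, fun θ x => ⟨fun h => (hc θ).fixedPoint_unique h, ?_⟩⟩
  rintro rfl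
  exact (hc θ).fixedPoint_isFixedPt

theorem norm_sub_fixedPoint_le {xbar : G → E} (hρ1 : ρ < 1)
    (hlip : ∀ x y θ, ‖F (x, θ) - F (y, θ)‖ ≤ ρ * ‖x - y‖)
    (hx : ∀ θ, F (xbar θ, θ) = xbar θ) (θ θ' : G) :
    ‖xbar θ - xbar θ'‖ ≤ (1 - ρ)⁻¹ * ‖F (xbar θ', θ) - F (xbar θ', θ')‖ := by
  rw [inv_mul_eq_div, le_div_iff₀ (sub_pos.2 hρ1)]
  have h1 := hlip (xbar θ) (xbar θ') θ
  have h2 := norm_add_le (F (xbar θ, θ) - F (xbar θ', θ)) (F (xbar θ', θ) - F (xbar θ', θ'))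
  rw [sub_add_sub_cancel, hx θ, hx θ'] at h2
  rw [hx θ] at h1
  rw [hx θ']
  linarith

theorem locallyLipschitz_fixedPoint {xbar : G → E} (hF : LocallyLipschitz F) (hρ1 : ρ < 1)
    (hlip : ∀ x y θ, ‖F (x, θ) - F (y, θ)‖ ≤ ρ * ‖x - y‖)
    (hx : ∀ θ, F (xbar θ, θ) = xbar θ) : LocallyLipschitz xbar := by
  -- Continuity comes first: it keeps `xbar θ'` in the neighbourhood where `F` has a Lipschitz
  -- constant.
  have hcont : Continuous xbar := continuous_iff_continuousAt.2 fun θ₀ => by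
    rw [ContinuousAt, tendsto_iff_norm_sub_tendsto_zero]
    refine squeeze_zero (fun _ => norm_nonneg _)
      (fun θ => norm_sub_fixedPoint_le hρ1 hlip hx θ θ₀) ?_
    have : Continuous fun θ => (1 - ρ)⁻¹ * ‖F (xbar θ₀, θ) - F (xbar θ₀, θ₀)‖ := by
      have := hF.continuous
      fun_prop
    simpa using this.tendsto θ₀
  intro θ₀
  obtain ⟨K, U, hU, hK⟩ := hF (xbar θ₀, θ₀)
  obtain ⟨V, hV, W, hW, hVW⟩ := mem_nhds_prod_iff.1 hU
  refine ⟨(1 - ρ)⁻¹.toNNReal * K, W ∩ xbar ⁻¹' V,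
    inter_mem hW (hcont.continuousAt hV), LipschitzOnWith.of_dist_le_mul fun θ hθ θ' hθ' => ?_⟩
  have h := hK.dist_le_mul (xbar θ', θ) (hVW ⟨hθ'.2, hθ.1⟩) (xbar θ', θ') (hVW ⟨hθ'.2, hθ'.1⟩)
  rw [dist_prod_same_left, dist_eq_norm] at h
  rw [dist_eq_norm, NNReal.coe_mul, Real.coe_toNNReal _ (inv_nonneg.2 (sub_pos.2 hρ1).le),
    mul_assoc]
  refine (norm_sub_fixedPoint_le hρ1 hlip hx θ θ').trans ?_
  have := inv_nonneg.2 (sub_pos.2 hρ1).le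
  gcongr

theorem locallyLipschitz_iter {x₀ : G → E} (hF : LocallyLipschitz F) (hx₀ : LocallyLipschitz x₀)
    (k : ℕ) : LocallyLipschitz (iter F x₀ k) := by
  induction k with
  | zero => exact hx₀
  | succ k ih => exact hF.comp (ih.prodMk LocallyLipschitz.id)

theorem norm_iter_sub_fixedPoint_le {xbar x₀ : G → E} (hρ0 : 0 ≤ ρ)
    (hlip : ∀ x y θ, ‖F (x, θ) - F (y, θ)‖ ≤ ρ * ‖x - y‖)
    (hx : ∀ θ, F (xbar θ, θ) = xbar θ) (θ : G) (k : ℕ) :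
    ‖iter F x₀ k θ - xbar θ‖ ≤ ‖x₀ θ - xbar θ‖ * ρ ^ k := by
  induction k with
  | zero => simp [iter]
  | succ k ih =>
    have h := hlip (iter F x₀ k θ) (xbar θ) θ
    rw [hx θ] at h
    refine h.trans ?_
    calc ρ * ‖iter F x₀ k θ - xbar θ‖ ≤ ρ * (‖x₀ θ - xbar θ‖ * ρ ^ k) := by gcongr
      _ = _ := by ring

/-! ### The fixed set -/

theorem act_eq_image (𝒥 : Set (E × G →L[ℝ] E)) (K : Set (G →L[ℝ] E)) :
    act 𝒥 K = (fun q : (E × G →L[ℝ] E) × (G →L[ℝ] E) => (blockA q.1).comp q.2 + blockB q.1) ''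
      (𝒥 ×ˢ K) := by
  ext Y
  constructor
  · rintro ⟨T, hT, X, hX, rfl⟩
    exact ⟨(T, X), ⟨hT, hX⟩, rfl⟩
  · rintro ⟨⟨T, X⟩, ⟨hT, hX⟩, rfl⟩
    exact ⟨T, hT, X, hX, rfl⟩

theorem isCompact_act {𝒥 : Set (E × G →L[ℝ] E)} {K : Set (G →L[ℝ] E)} (h𝒥 : IsCompact 𝒥)
    (hK : IsCompact K) : IsCompact (act 𝒥 K) := by
  rw [act_eq_image]
  refine (h𝒥.prod hK).image ?_
  unfold blockA blockB
  fun_prop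

theorem nonempty_act {𝒥 : Set (E × G →L[ℝ] E)} {K : Set (G →L[ℝ] E)} (h𝒥 : 𝒥.Nonempty)
    (hK : K.Nonempty) : (act 𝒥 K).Nonempty := by
  rw [act_eq_image]
  exact (h𝒥.prod hK).image _

/-- Keep the same `T` and replace `X` by a nearest point of `K'`: the block `B` cancels and `A`
contracts. -/
theorem exists_act_edist_le {𝒥 : Set (E × G →L[ℝ] E)} {r : ℝ≥0}
    (hr : ∀ T ∈ 𝒥, ‖blockA T‖ ≤ r) {K K' : Set (G →L[ℝ] E)} (hK' : IsCompact K')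
    (hne : K'.Nonempty) {Y : G →L[ℝ] E} (hY : Y ∈ act 𝒥 K) :
    ∃ Y' ∈ act 𝒥 K', edist Y Y' ≤ r * Metric.hausdorffEDist K K' := by
  obtain ⟨T, hT, X, hX, rfl⟩ := hY
  obtain ⟨X', hX', hd⟩ := hK'.exists_infEDist_eq_edist hne X
  refine ⟨_, ⟨T, hT, X', hX', rfl⟩, ?_⟩
  rw [edist_add_right]
  have hl : LipschitzWith r fun X : G →L[ℝ] E => (blockA T).comp X :=
    LipschitzWith.of_dist_le_mul fun X X' => by
      rw [dist_eq_norm, dist_eq_norm, ← ContinuousLinearMap.comp_sub]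
      exact (ContinuousLinearMap.opNorm_comp_le _ _).trans
        (mul_le_mul_of_nonneg_right (hr T hT) (norm_nonneg _))
  refine (hl X X').trans ?_
  rw [← hd]
  gcongr
  exact Metric.infEDist_le_hausdorffEDist_of_mem hX

/-- A compact family of contracting affine maps has exactly one nonempty compact fixed set. -/
theorem exists_fixedSet [CompleteSpace E] {𝒥 : Set (E × G →L[ℝ] E)} (h𝒥 : IsCompact 𝒥)
    (hne : 𝒥.Nonempty) (hρ0 : 0 ≤ ρ) (hρ1 : ρ < 1) (hρ : ∀ T ∈ 𝒥, ‖blockA T‖ ≤ ρ) :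
    ∃ K₀ : Set (G →L[ℝ] E), ∀ K, IsFixedSet 𝒥 K ↔ K = K₀ := by
  lift ρ to ℝ≥0 using hρ0
  let Φ : TopologicalSpace.NonemptyCompacts (G →L[ℝ] E) →
      TopologicalSpace.NonemptyCompacts (G →L[ℝ] E) := fun K =>
    ⟨⟨act 𝒥 K, isCompact_act h𝒥 K.isCompact⟩, nonempty_act hne K.nonempty⟩
  have hΦ : ContractingWith ρ Φ := by
    refine ⟨by exact_mod_cast hρ1, fun K K' => ?_⟩
    refine Metric.hausdorffEDist_le_of_mem_edist
      (fun Y hY => exists_act_edist_le hρ K'.isCompact K'.nonempty hY) (fun Y hY => ?_)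
    have := exists_act_edist_le hρ K.isCompact K.nonempty hY
    rwa [Metric.hausdorffEDist_comm] at this
  have : Nonempty (TopologicalSpace.NonemptyCompacts (G →L[ℝ] E)) := ⟨{0}⟩
  obtain ⟨K₀, hK₀, huniq⟩ : ∃ K₀, Φ K₀ = K₀ ∧ ∀ K, Φ K = K → K = K₀ :=
    ⟨ContractingWith.fixedPoint Φ hΦ, hΦ.fixedPoint_isFixedPt, fun _ h => hΦ.fixedPoint_unique h⟩
  refine ⟨K₀, fun K => ⟨?_, ?_⟩⟩
  · rintro ⟨hK1, hK2, hK3⟩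
    exact congrArg SetLike.coe (huniq ⟨⟨K, hK2⟩, hK1⟩ (SetLike.coe_injective hK3))
  · rintro rfl
    exact ⟨K₀.nonempty, K₀.isCompact, congrArg SetLike.coe hK₀⟩

end Selection
-- Rademacher's theorem and derivatives on coincidence sets
section AlmostEverywhere

variable {E G : Type*} [NormedAddCommGroup E] [NormedSpace ℝ E] [FiniteDimensional ℝ E]
  [NormedAddCommGroup G] [NormedSpace ℝ G] [FiniteDimensional ℝ G]
  [MeasurableSpace G] [BorelSpace G] (μ : Measure G) [μ.IsAddHaarMeasure]

theorem ae_differentiableAt_of_locallyLipschitz {g : G → E} (hg : LocallyLipschitz g) :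
    ∀ᵐ x ∂μ, DifferentiableAt ℝ g x := by
  choose K U hU hK using hg
  obtain ⟨t, htc, ht⟩ := TopologicalSpace.countable_cover_nhds fun x => interior_mem_nhds.2 (hU x)
  have h : ∀ᵐ x ∂μ, ∀ y ∈ t, x ∈ U y → DifferentiableWithinAt ℝ g (U y) x :=
    (ae_ball_iff htc).2 fun y _ => (hK y).ae_differentiableWithinAt_of_mem
  filter_upwards [h] with x hx
  have hxu : x ∈ ⋃ y ∈ t, interior (U y) := ht ▸ mem_univ x
  obtain ⟨y, hy, hxy⟩ := mem_iUnion₂.1 hxu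
  exact (hx y hy (interior_subset hxy)).differentiableAt (mem_interior_iff_mem_nhds.1 hxy)

/-- On `S` the map `u` is approximated by the zero linear map with constant `0`, which bounds the
derivative by `0` almost everywhere. Multiplying by a nonzero `v` makes it a self-map of `G`, as
that bound requires. -/
theorem ae_fderiv_eq_zero_of_real {u : G → ℝ} {S : Set G} (hS : MeasurableSet S)
    (hu : ∀ x ∈ S, u x = 0) :
    ∀ᵐ x ∂μ, x ∈ S → DifferentiableAt ℝ u x → fderiv ℝ u x = 0 := by
  rcases subsingleton_or_nontrivial G with hG | hG
  · refine Eventually.of_forall fun x _ _ => ?_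
    ext v
    simp [Subsingleton.elim v 0]
  obtain ⟨v, hv⟩ := exists_ne (0 : G)
  set S' := S ∩ {x | DifferentiableAt ℝ u x} with hS'
  have hm : MeasurableSet S' := hS.inter (measurableSet_of_differentiableAt ℝ u)
  have happ : ApproximatesLinearOn (fun x => u x • v) (0 : G →L[ℝ] G) S' 0 := by
    rintro x hx y hy
    simp [hu x hx.1, hu y hy.1]
  have h := happ.norm_fderiv_sub_le μ hm (fun x => (fderiv ℝ u x).smulRight v)
    fun x hx => (hx.2.hasFDerivAt.smul_const v).hasFDerivWithinAt
  rw [ae_restrict_iff' hm] at h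
  filter_upwards [h] with x hx hxS hxd
  have h0 := hx ⟨hxS, hxd⟩
  simpa [hv] using h0

/-- Two maps have the same derivative at almost every point where they agree and are both
differentiable. -/
theorem ae_fderiv_eq_of_eq {g₁ g₂ : G → E} (h₁ : Continuous g₁) (h₂ : Continuous g₂) :
    ∀ᵐ x ∂μ, g₁ x = g₂ x → DifferentiableAt ℝ g₁ x → DifferentiableAt ℝ g₂ x →
      fderiv ℝ g₁ x = fderiv ℝ g₂ x := by
  let b := Module.finBasis ℝ E
  let c : Fin (Module.finrank ℝ E) → E →L[ℝ] ℝ := fun i => LinearMap.toContinuousLinearMap (b.coord i)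
  have hS : MeasurableSet {x | g₁ x = g₂ x} := (isClosed_eq h₁ h₂).measurableSet
  have h : ∀ᵐ x ∂μ, ∀ i, x ∈ {x | g₁ x = g₂ x} →
      DifferentiableAt ℝ (fun x => c i (g₁ x - g₂ x)) x →
      fderiv ℝ (fun x => c i (g₁ x - g₂ x)) x = 0 :=
    ae_all_iff.2 fun i => ae_fderiv_eq_zero_of_real μ hS fun x (hx : g₁ x = g₂ x) => by simp [hx]
  filter_upwards [h] with x hx hxe hd₁ hd₂
  ext v
  refine b.ext_elem fun i => ?_
  have hd := (c i).hasFDerivAt.comp x (hd₁.hasFDerivAt.sub hd₂.hasFDerivAt)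
  have h0 := hx i hxe hd.differentiableAt
  have h1 : (c i).comp (fderiv ℝ g₁ x - fderiv ℝ g₂ x) = 0 := hd.fderiv.symm.trans h0
  have h2 := DFunLike.congr_fun h1 v
  simpa [c, sub_eq_zero] using h2

end AlmostEverywhere
/-- A family of upward closed predicates satisfying an affine recursion with ratio `ρ < r` and a
perturbation of order `r ^ k` holds for a bound of order `r ^ k`. -/
theorem exists_geometric_bound {P : ℕ → ℝ → Prop} {ρ r D : ℝ} {N : ℕ} (hρ0 : 0 ≤ ρ) (hr : ρ < r)
    (hD : 0 ≤ D) (hmono : ∀ k a b, a ≤ b → P k a → P k b) (hex : ∀ k, ∃ a, P k a)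
    (hstep : ∀ k ≥ N, ∀ a ≥ 0, P k a → P (k + 1) (ρ * a + D * r ^ k)) :
    ∃ C > (0 : ℝ), ∀ k, P k (C * r ^ k) := by
  have hr0 : 0 < r := hρ0.trans_lt hr
  choose c hc using hex
  set S := ∑ k ∈ Finset.range (N + 1), |c k| / r ^ k with hS
  have hS0 : 0 ≤ S := Finset.sum_nonneg fun k _ => by positivity
  have hq : 0 ≤ D / (r - ρ) := div_nonneg hD (sub_pos.2 hr).le
  -- `S` covers the indices up to `N`, `D / (r - ρ)` gives `ρ * C + D ≤ C * r` for the induction,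
  -- and `1` ensures positivity.
  set C := S + D / (r - ρ) + 1 with hC
  have hsmall : ∀ k ≤ N, P k (C * r ^ k) := fun k hk => by
    refine hmono k _ _ ?_ (hc k)
    have h1 : |c k| / r ^ k ≤ S :=
      Finset.single_le_sum (f := fun k => |c k| / r ^ k) (fun k _ => by positivity)
        (Finset.mem_range.2 (Nat.lt_succ_of_le hk))
    have h2 : |c k| / r ^ k ≤ C := by linarith
    rw [div_le_iff₀ (pow_pos hr0 k)] at h2
    exact (le_abs_self _).trans h2
  refine ⟨C, by linarith, fun k => ?_⟩
  induction k with
  | zero => exact hsmall 0 (Nat.zero_le _)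
  | succ k ih =>
    rcases Nat.lt_or_ge k N with hk | hk
    · exact hsmall _ hk
    · refine hmono _ _ _ ?_ (hstep k hk _ (by positivity) ih)
      have h1 : D ≤ C * (r - ρ) := by
        rw [← div_le_iff₀ (sub_pos.2 hr)]
        linarith
      have h2 := mul_le_mul_of_nonneg_right h1 (pow_pos hr0 k).le
      rw [pow_succ]
      linarith

theorem gap_le_of_forall_exists {V : Type*} [PseudoMetricSpace V] {𝒳 𝒴 : Set V} {c : ℝ}
    (h : ∀ x ∈ 𝒳, ∃ y ∈ 𝒴, dist x y ≤ c) : gap 𝒳 𝒴 ≤ ENNReal.ofReal c := by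
  refine iSup₂_le fun x hx => ?_
  obtain ⟨y, hy, hxy⟩ := h x hx
  refine iInf₂_le_of_le y hy ?_
  rw [edist_dist]
  exact ENNReal.ofReal_le_ofReal hxy

/-! ### Linear convergence of the set-valued recursion -/

section Convergence

variable {E G : Type*} [NormedAddCommGroup E] [NormedSpace ℝ E]
  [NormedAddCommGroup G] [NormedSpace ℝ G]
  {ι : Type*} [Finite ι] {F : E × G → E} {f : ι → E × G → E} {ρ : ℝ}

/-- The selection Jacobian is Lipschitz at `z` in the sense of the gap. -/
theorem eventually_exists_selectionJacobian_norm_sub_le (hF : Continuous F)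
    (hf : ∀ i, Continuous (f i)) {L : ℝ≥0} (hL : ∀ i, LipschitzWith L (fderiv ℝ (f i)))
    (z : E × G) : ∀ᶠ w in 𝓝 z, ∀ T ∈ selectionJacobian F f w,
      ∃ T' ∈ selectionJacobian F f z, ‖T - T'‖ ≤ L * ‖w - z‖ := by
  filter_upwards [eventually_active hF hf z] with w hw T hT
  have hsub : selectionJacobian F f w ⊆
      selectionJacobian F f z + Metric.closedBall 0 (L * ‖w - z‖) := by
    -- The thickened hull is convex, so only the generators need checking.
    refine convexHull_min ?_ ((convex_convexHull ℝ _).add (convex_closedBall _ _))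
    rintro _ ⟨i, hi, rfl⟩
    refine ⟨_, fderiv_mem_selectionJacobian (hw i hi), fderiv ℝ (f i) w - fderiv ℝ (f i) z, ?_,
      add_sub_cancel _ _⟩
    rw [mem_closedBall_zero_iff, ← dist_eq_norm, ← dist_eq_norm]
    exact (hL i).dist_le_mul w z
  obtain ⟨T', hT', U, hU, rfl⟩ := hsub hT
  exact ⟨T', hT', by simpa using hU⟩

/-- The difference is `A (X - X') + (T - T') (X', id)`. Only `X'`, later taken in the fixed compact
set, enters the perturbation term, so no bound on the iterates is needed. -/
theorem norm_act_sub_le (T T' : E × G →L[ℝ] E) (X X' : G →L[ℝ] E) :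
    ‖((blockA T).comp X + blockB T) - ((blockA T').comp X' + blockB T')‖ ≤
      ‖blockA T‖ * ‖X - X'‖ + ‖T - T'‖ * (‖X'‖ + 1) := by
  have h : ((blockA T).comp X + blockB T) - ((blockA T').comp X' + blockB T') =
      (blockA T).comp (X - X') + (T - T').comp (X'.prod (ContinuousLinearMap.id ℝ G)) := by
    rw [ContinuousLinearMap.sub_comp, ← blockA_comp_add_blockB T X', ← blockA_comp_add_blockB T' X',
      ContinuousLinearMap.comp_sub]
    abel
  rw [h]
  refine (norm_add_le _ _).trans (add_le_add (ContinuousLinearMap.opNorm_comp_le _ _) ?_)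
  refine (ContinuousLinearMap.opNorm_comp_le _ _).trans ?_
  gcongr
  rw [ContinuousLinearMap.opNorm_prod]
  have h1 : ‖ContinuousLinearMap.id ℝ G‖ ≤ 1 := ContinuousLinearMap.norm_id_le
  exact max_le (by linarith) (by linarith [norm_nonneg X'])

variable {x₀ xbar : G → E} {J₀ : G → Set (G →L[ℝ] E)}

theorem isCompact_piggyback {θ : G} (hJ₀ : IsCompact (J₀ θ)) (k : ℕ) :
    IsCompact (piggyback F (selectionJacobian F f) x₀ J₀ k θ) := by
  induction k with
  | zero => exact hJ₀
  | succ k ih => exact isCompact_act (isCompact_selectionJacobian _ _ _) ih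

/-- The piggyback recursion converges linearly to a fixed set at the limit. -/
theorem exists_piggyback_bound (hF : Continuous F) (hf : ∀ i, Differentiable ℝ (f i))
    {L : ℝ≥0} (hL : ∀ i, LipschitzWith L (fderiv ℝ (f i)))
    (hρ0 : 0 ≤ ρ) (hρ1 : ρ < 1) (hρ : ∀ z, ∀ T ∈ selectionJacobian F f z, ‖blockA T‖ ≤ ρ)
    {θ : G} {d : ℝ} (hd : ∀ k, ‖iter F x₀ k θ - xbar θ‖ ≤ d * ρ ^ k)
    (hJ₀ : IsCompact (J₀ θ)) {K : Set (G →L[ℝ] E)}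
    (hK : IsFixedSet (selectionJacobian F f (xbar θ, θ)) K) {r : ℝ} (hr : ρ < r) :
    ∃ C > (0 : ℝ), ∀ k, ∀ X ∈ piggyback F (selectionJacobian F f) x₀ J₀ k θ,
      ∃ Y ∈ K, dist X Y ≤ C * r ^ k := by
  obtain ⟨⟨Y₀, hY₀⟩, hKc, hKact⟩ := hK
  have hr0 : 0 < r := hρ0.trans_lt hr
  have hd0 : 0 ≤ d := by simpa using (norm_nonneg _).trans (hd 0)
  obtain ⟨b, hb0, hb⟩ := hKc.isBounded.exists_pos_norm_le
  have hlim : Tendsto (fun k => (iter F x₀ k θ, θ)) atTop (𝓝 (xbar θ, θ)) := by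
    refine Tendsto.prodMk_nhds ?_ tendsto_const_nhds
    rw [tendsto_iff_norm_sub_tendsto_zero]
    refine squeeze_zero (fun _ => norm_nonneg _) hd ?_
    simpa using (tendsto_pow_atTop_nhds_zero_of_lt_one hρ0 hρ1).const_mul d
  obtain ⟨N, hN⟩ := eventually_atTop.1 (hlim.eventually
    (eventually_exists_selectionJacobian_norm_sub_le hF (fun i => (hf i).continuous) hL
      (xbar θ, θ)))
  refine exists_geometric_bound
    (P := fun k a => ∀ X ∈ piggyback F (selectionJacobian F f) x₀ J₀ k θ, ∃ Y ∈ K, dist X Y ≤ a)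
    (N := N) (D := L * d * (b + 1)) hρ0 hr (by positivity)
    (fun k a a' haa h X hX => ?_) (fun k => ?_) (fun k hk a ha h X hX => ?_)
  · obtain ⟨Y, hY, hXY⟩ := h X hX
    exact ⟨Y, hY, hXY.trans haa⟩
  · obtain ⟨R, hR⟩ := (isCompact_piggyback (F := F) (f := f) (x₀ := x₀)
      hJ₀ k).isBounded.subset_closedBall Y₀
    exact ⟨R, fun X hX => ⟨Y₀, hY₀, hR hX⟩⟩
  · obtain ⟨T, hT, X, hX, rfl⟩ := hX
    obtain ⟨Y, hY, hXY⟩ := h X hX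
    obtain ⟨T', hT', hTT'⟩ := hN k hk T hT
    refine ⟨_, hKact.subset ⟨T', hT', Y, hY, rfl⟩, ?_⟩
    rw [dist_eq_norm] at hXY ⊢
    have hz : ‖((iter F x₀ k θ, θ) : E × G) - (xbar θ, θ)‖ ≤ d * r ^ k := by
      have h1 : ‖((iter F x₀ k θ, θ) : E × G) - (xbar θ, θ)‖ = ‖iter F x₀ k θ - xbar θ‖ := by
        simp [Prod.norm_def]
      rw [h1]
      refine (hd k).trans ?_
      gcongr
    calc _ ≤ ‖blockA T‖ * ‖X - Y‖ + ‖T - T'‖ * (‖Y‖ + 1) := norm_act_sub_le _ _ _ _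
      _ ≤ ρ * a + (L * (d * r ^ k)) * (b + 1) := by
        gcongr
        · exact hρ _ T hT
        · exact hTT'.trans (by gcongr)
        · exact hb Y hY
      _ = ρ * a + L * d * (b + 1) * r ^ k := by ring

end Convergence

/-! ### The chain rule almost everywhere -/

section AlmostEverywhere

variable {E G : Type*} [NormedAddCommGroup E] [NormedSpace ℝ E] [FiniteDimensional ℝ E]
  [NormedAddCommGroup G] [NormedSpace ℝ G] [FiniteDimensional ℝ G]
  [MeasurableSpace G] [BorelSpace G] (μ : Measure G) [μ.IsAddHaarMeasure]
  {ι : Type*} [Finite ι] {F : E × G → E} {f : ι → E × G → E}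

/-- The selection Jacobian satisfies the chain rule almost everywhere along locally Lipschitz
maps. -/
theorem ae_fderiv_eq_blockA_comp_add_blockB (hF : LocallyLipschitz F)
    (hf : ∀ i, Differentiable ℝ (f i)) {y : G → E} (hy : LocallyLipschitz y) :
    ∀ᵐ θ ∂μ, ∀ T ∈ selectionJacobian F f (y θ, θ),
      fderiv ℝ (fun θ => F (y θ, θ)) θ = (blockA T).comp (fderiv ℝ y θ) + blockB T := by
  have hΦ : LocallyLipschitz fun θ => (y θ, θ) := hy.prodMk LocallyLipschitz.id
  have hagree : ∀ᵐ θ ∂μ, ∀ i, F (y θ, θ) = f i (y θ, θ) →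
      DifferentiableAt ℝ (fun θ => F (y θ, θ)) θ → DifferentiableAt ℝ (fun θ => f i (y θ, θ)) θ →
      fderiv ℝ (fun θ => F (y θ, θ)) θ = fderiv ℝ (fun θ => f i (y θ, θ)) θ :=
    ae_all_iff.2 fun i => ae_fderiv_eq_of_eq μ (hF.continuous.comp hΦ.continuous)
      ((hf i).continuous.comp hΦ.continuous)
  filter_upwards [hagree, ae_differentiableAt_of_locallyLipschitz μ hy,
    ae_differentiableAt_of_locallyLipschitz μ (hF.comp hΦ)] with θ h hdy hdF T hT
  rw [blockA_comp_add_blockB]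
  -- The chain rule is an affine condition on `T`, so it passes from active pieces to their convex
  -- hull.
  have hsub : selectionJacobian F f (y θ, θ) ⊆
      {T | T.comp ((fderiv ℝ y θ).prod (ContinuousLinearMap.id ℝ G)) =
        fderiv ℝ (fun θ => F (y θ, θ)) θ} := by
    refine convexHull_min ?_ fun T hT T' hT' a b _ _ hab => ?_
    · rintro _ ⟨i, hi, rfl⟩
      have hd : HasFDerivAt (fun θ => f i (y θ, θ)) ((fderiv ℝ (f i) (y θ, θ)).comp
          ((fderiv ℝ y θ).prod (ContinuousLinearMap.id ℝ G))) θ :=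
        HasFDerivAt.comp (f := fun θ => (y θ, θ)) θ (hf i (y θ, θ)).hasFDerivAt
          (hdy.hasFDerivAt.prodMk (hasFDerivAt_id θ))
      exact (hd.fderiv.symm.trans (h i hi hdF hd.differentiableAt).symm)
    · rw [mem_ofPred_eq] at hT hT' ⊢
      rw [ContinuousLinearMap.add_comp, ContinuousLinearMap.smul_comp,
        ContinuousLinearMap.smul_comp, hT, hT', ← add_smul, hab, one_smul]
  exact (hsub hT).symm

end AlmostEverywhere
end Piggyback

theorem mainTheorem5 {p m M : ℕ}
    (F : EuclideanSpace ℝ (Fin p) × EuclideanSpace ℝ (Fin m) → EuclideanSpace ℝ (Fin p))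
    (s : EuclideanSpace ℝ (Fin p) × EuclideanSpace ℝ (Fin m) → Fin M)
    (f : Fin M → EuclideanSpace ℝ (Fin p) × EuclideanSpace ℝ (Fin m) → EuclideanSpace ℝ (Fin p))
    (hF : LocallyLipschitz F)
    (hsel : Piggyback.IsLipschitzGradientSelection F s f)
    (ρ : ℝ) (hρ0 : 0 ≤ ρ) (hρ1 : ρ < 1)
    (hcontr : ∀ z, ∀ T ∈ Piggyback.selectionJacobian F f z, ‖Piggyback.blockA T‖ ≤ ρ)
    (x₀ : EuclideanSpace ℝ (Fin m) → EuclideanSpace ℝ (Fin p))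
    (hx₀ : LocallyLipschitz x₀)
    (J₀ : EuclideanSpace ℝ (Fin m) →
      Set (EuclideanSpace ℝ (Fin m) →L[ℝ] EuclideanSpace ℝ (Fin p)))
    (hJ₀ : ∀ θ, (J₀ θ).Nonempty ∧ IsCompact (J₀ θ)) :
    ∃ (xbar : EuclideanSpace ℝ (Fin m) → EuclideanSpace ℝ (Fin p))
      (Jalg : EuclideanSpace ℝ (Fin m) →
        Set (EuclideanSpace ℝ (Fin m) →L[ℝ] EuclideanSpace ℝ (Fin p))),
      -- `xbar θ` is the unique fixed point of `F (·, θ)`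
      (∀ θ x, F (x, θ) = x ↔ x = xbar θ) ∧
      -- `Jalg θ` is the unique nonempty compact fixed set of the selection Jacobian there
      (∀ θ K, Piggyback.IsFixedSet (Piggyback.selectionJacobian F f (xbar θ, θ)) K ↔
        K = Jalg θ) ∧
      -- linear convergence of the set-valued piggyback recursion, for every `θ`
      (∀ θ, ∀ ε > (0 : ℝ), ∃ C > (0 : ℝ), ∀ k : ℕ,
        Piggyback.gap
            (Piggyback.piggyback F (Piggyback.selectionJacobian F f) x₀ J₀ k θ) (Jalg θ) ≤
          ENNReal.ofReal (C * (√ρ + ε) ^ k)) ∧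
      -- linear convergence of the classical Jacobians, for almost every `θ`
      (∀ᵐ θ ∂(MeasureTheory.volume : MeasureTheory.Measure (EuclideanSpace ℝ (Fin m))),
        (∀ k, DifferentiableAt ℝ (Piggyback.iter F x₀ k) θ) ∧ DifferentiableAt ℝ xbar θ ∧
        ∀ ε > (0 : ℝ), ∃ C > (0 : ℝ), ∀ k : ℕ,
          ‖fderiv ℝ (Piggyback.iter F x₀ k) θ - fderiv ℝ xbar θ‖ ≤ C * (√ρ + ε) ^ k) := by
  obtain ⟨L, hL⟩ := hsel.lipschitz_jacobian
  have hf := hsel.differentiable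
  have hs : ∀ z, ∃ i, F z = f i z := fun z => ⟨s z, hsel.selection z⟩
  have hlip := Piggyback.norm_sub_le_of_blockA_le hsel.continuous hf hs hcontr
  have hne : ∀ z, (Piggyback.selectionJacobian F f z).Nonempty := fun z =>
    ⟨_, Piggyback.fderiv_mem_selectionJacobian (hsel.selection z)⟩
  obtain ⟨xbar, hxbar⟩ := Piggyback.exists_fixedPoint_map hρ0 hρ1 hlip
  have hfix : ∀ θ, F (xbar θ, θ) = xbar θ := fun θ => (hxbar θ _).2 rfl
  choose Jalg hJalg using fun θ => Piggyback.exists_fixedSet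
    (Piggyback.isCompact_selectionJacobian F f (xbar θ, θ)) (hne _) hρ0 hρ1 (hcontr _)
  have hrate : ∀ ε > (0 : ℝ), ρ < √ρ + ε := fun ε hε => by
    have : ρ ≤ √ρ := Real.le_sqrt_of_sq_le (by nlinarith)
    linarith
  have hiter := Piggyback.norm_iter_sub_fixedPoint_le (x₀ := x₀) hρ0 hlip hfix
  refine ⟨xbar, Jalg, hxbar, hJalg, fun θ ε hε => ?_, ?_⟩
  · obtain ⟨C, hC, h⟩ := Piggyback.exists_piggyback_bound hsel.continuous hf hL hρ0 hρ1 hcontr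
      (hiter θ) (hJ₀ θ).2 ((hJalg θ _).2 rfl) (hrate ε hε)
    exact ⟨C, hC, fun k => Piggyback.gap_le_of_forall_exists (h k)⟩
  have hlx := Piggyback.locallyLipschitz_fixedPoint hF hρ1 hlip hfix
  have hlk := Piggyback.locallyLipschitz_iter hF hx₀
  filter_upwards [ae_all_iff.2 fun k =>
      Piggyback.ae_differentiableAt_of_locallyLipschitz volume (hlk k),
    Piggyback.ae_differentiableAt_of_locallyLipschitz volume hlx,
    ae_all_iff.2 fun k => Piggyback.ae_fderiv_eq_blockA_comp_add_blockB volume hF hf (hlk k),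
    Piggyback.ae_fderiv_eq_blockA_comp_add_blockB volume hF hf hlx] with θ hdk hdx hck hcx
  refine ⟨hdk, hdx, fun ε hε => ?_⟩
  have hself : (fun θ => F (xbar θ, θ)) = xbar := funext hfix
  rw [hself] at hcx
  have hfixed : Piggyback.IsFixedSet (Piggyback.selectionJacobian F f (xbar θ, θ))
      {fderiv ℝ xbar θ} := by
    refine ⟨singleton_nonempty _, isCompact_singleton, Subset.antisymm ?_ ?_⟩
    · rintro _ ⟨T, hT, _, rfl, rfl⟩
      exact (hcx T hT).symm
    · rintro _ rfl
      obtain ⟨T, hT⟩ := hne (xbar θ, θ)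
      exact ⟨T, hT, _, rfl, hcx T hT⟩
  -- The recursion is restarted from `{D x₀}` because `J₀ θ` need not contain the derivative of
  -- `x₀`.
  have hmem : ∀ k, fderiv ℝ (Piggyback.iter F x₀ k) θ ∈ Piggyback.piggyback F
      (Piggyback.selectionJacobian F f) x₀ (fun θ => {fderiv ℝ x₀ θ}) k θ := fun k => by
    induction k with
    | zero => exact rfl
    | succ k ih =>
      obtain ⟨T, hT⟩ := hne (Piggyback.iter F x₀ k θ, θ)
      exact ⟨T, hT, _, ih, hck k T hT⟩
  obtain ⟨C, hC, h⟩ := Piggyback.exists_piggyback_bound hsel.continuous hf hL hρ0 hρ1 hcontr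
    (J₀ := fun θ => {fderiv ℝ x₀ θ}) (hiter θ) isCompact_singleton hfixed (hrate ε hε)
  refine ⟨C, hC, fun k => ?_⟩
  obtain ⟨_, rfl, hY⟩ := h k _ (hmem k)
  rwa [dist_eq_norm] at hY
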